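/- Let $K$ be a field of characteristic zero, let $D=\frac{d}{dt}$ be the usual derivation of $K(t)$ and $\Delta=tD$, and let $K(t)[D]=K(t)[\Delta]$ be the ring of linear differential operators with coefficients in $K(t)$ (with composition as product). Let $m\ge 2$ and let $N,P_1,\dots,P_m\in K[t]$ have degrees $S=\deg N$ and $r_j=\deg P_j$ (with $\deg 0=-\infty$). Assume that $$S\ge 0,\qquad r_m=S+1,\qquad r_j<r_m\quad (j=1,\dots,m-1).$$ Then the differential operator $$E(\Delta,t)=N\Delta^m-P_1\Delta^{m-1}-\dots-P_m$$ is irreducible over $K(t)$, that is, it is an irreducible element of the ring $K(t)[\Delta]$: it is not a unit, and whenever $E(\Delta,t)=AB$ with $A,B\in K(t)[\Delta]$, one of $A,B$ is a unit (a nonzero element of $K(t)$). Equivalently, it is not the product of two elements of $K(t)[\Delta]$ of order strictly smaller than $m$. -/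

import Mathlib

open scoped Polynomial

noncomputable section

namespace RatDiffOp

variable {K : Type*} [Field K]

/-- The quotient rule `(p / q)' = (p' q - p q') / q ^ 2`, for polynomials `p`, `q`. -/
def quotRule (p q : K[X]) : RatFunc K :=
  (algebraMap K[X] (RatFunc K) (Polynomial.derivative p) * algebraMap K[X] (RatFunc K) q -
      algebraMap K[X] (RatFunc K) p * algebraMap K[X] (RatFunc K) (Polynomial.derivative q)) /
    algebraMap K[X] (RatFunc K) q ^ 2

/-- The derivative of a rational function, from its reduced fraction. -/
def ratDeriv (f : RatFunc K) : RatFunc K := quotRule f.num f.denom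

/-- Any fraction representing `f` may be used to compute the derivative of `f`. -/
theorem ratDeriv_div (p q : K[X]) (hq : q ≠ 0) :
    ratDeriv (algebraMap K[X] (RatFunc K) p / algebraMap K[X] (RatFunc K) q) = quotRule p q := by
  set f : RatFunc K := algebraMap K[X] (RatFunc K) p / algebraMap K[X] (RatFunc K) q with hf
  have hd : f.denom ≠ 0 := f.denom_ne_zero
  have hq' : algebraMap K[X] (RatFunc K) q ≠ 0 := RatFunc.algebraMap_ne_zero hq
  have hd' : algebraMap K[X] (RatFunc K) f.denom ≠ 0 := RatFunc.algebraMap_ne_zero hd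
  have h1 : f.num * q = p * f.denom := by
    apply RatFunc.algebraMap_injective K
    rw [map_mul, map_mul]
    have h2 := RatFunc.num_div_denom f
    rw [hf, div_eq_div_iff hd' hq'] at h2
    exact h2
  have h3 := congrArg Polynomial.derivative h1
  rw [Polynomial.derivative_mul, Polynomial.derivative_mul] at h3
  have h1' := congrArg (algebraMap K[X] (RatFunc K)) h1
  have h3' := congrArg (algebraMap K[X] (RatFunc K)) h3
  simp only [map_mul, map_add] at h1' h3'
  unfold ratDeriv quotRule
  rw [div_eq_div_iff (pow_ne_zero 2 hd') (pow_ne_zero 2 hq')]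
  generalize algebraMap K[X] (RatFunc K) f.num = a at *
  generalize algebraMap K[X] (RatFunc K) f.denom = b at *
  generalize algebraMap K[X] (RatFunc K) (Polynomial.derivative f.num) = a' at *
  generalize algebraMap K[X] (RatFunc K) (Polynomial.derivative f.denom) = b' at *
  generalize algebraMap K[X] (RatFunc K) p = c at *
  generalize algebraMap K[X] (RatFunc K) q = d at *
  generalize algebraMap K[X] (RatFunc K) (Polynomial.derivative p) = c' at *
  generalize algebraMap K[X] (RatFunc K) (Polynomial.derivative q) = d' at *
  linear_combination (b * d) * h3' - (b * d' + b' * d) * h1'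

theorem exists_div (f : RatFunc K) : ∃ p q : K[X], q ≠ 0 ∧
    f = algebraMap K[X] (RatFunc K) p / algebraMap K[X] (RatFunc K) q :=
  ⟨f.num, f.denom, f.denom_ne_zero, (RatFunc.num_div_denom f).symm⟩

theorem ratDeriv_add (f g : RatFunc K) : ratDeriv (f + g) = ratDeriv f + ratDeriv g := by
  obtain ⟨p, q, hq, rfl⟩ := exists_div f
  obtain ⟨r, s, hs, rfl⟩ := exists_div g
  have hq' : algebraMap K[X] (RatFunc K) q ≠ 0 := RatFunc.algebraMap_ne_zero hq
  have hs' : algebraMap K[X] (RatFunc K) s ≠ 0 := RatFunc.algebraMap_ne_zero hs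
  have h : algebraMap K[X] (RatFunc K) p / algebraMap K[X] (RatFunc K) q +
      algebraMap K[X] (RatFunc K) r / algebraMap K[X] (RatFunc K) s =
      algebraMap K[X] (RatFunc K) (p * s + q * r) / algebraMap K[X] (RatFunc K) (q * s) := by
    rw [div_add_div _ _ hq' hs']
    simp only [map_add, map_mul]
  rw [h, ratDeriv_div _ _ (mul_ne_zero hq hs), ratDeriv_div _ _ hq, ratDeriv_div _ _ hs]
  simp only [quotRule, Polynomial.derivative_mul, map_add, map_mul]
  field_simp
  ring

theorem ratDeriv_mul (f g : RatFunc K) : ratDeriv (f * g) = f * ratDeriv g + g * ratDeriv f := by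
  obtain ⟨p, q, hq, rfl⟩ := exists_div f
  obtain ⟨r, s, hs, rfl⟩ := exists_div g
  have hq' : algebraMap K[X] (RatFunc K) q ≠ 0 := RatFunc.algebraMap_ne_zero hq
  have hs' : algebraMap K[X] (RatFunc K) s ≠ 0 := RatFunc.algebraMap_ne_zero hs
  have h : algebraMap K[X] (RatFunc K) p / algebraMap K[X] (RatFunc K) q *
      (algebraMap K[X] (RatFunc K) r / algebraMap K[X] (RatFunc K) s) =
      algebraMap K[X] (RatFunc K) (p * r) / algebraMap K[X] (RatFunc K) (q * s) := by
    rw [div_mul_div_comm, map_mul, map_mul]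
  rw [h, ratDeriv_div _ _ (mul_ne_zero hq hs), ratDeriv_div _ _ hq, ratDeriv_div _ _ hs]
  simp only [quotRule, Polynomial.derivative_mul, map_add, map_mul]
  field_simp
  ring

theorem ratDeriv_algebraMap (p : K[X]) :
    ratDeriv (algebraMap K[X] (RatFunc K) p) =
      algebraMap K[X] (RatFunc K) (Polynomial.derivative p) := by
  have h := ratDeriv_div p 1 one_ne_zero
  simpa [quotRule] using h

theorem ratDeriv_smul (c : K) (f : RatFunc K) : ratDeriv (c • f) = c • ratDeriv f := by
  have hc : algebraMap K (RatFunc K) c = algebraMap K[X] (RatFunc K) (Polynomial.C c) :=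
    IsScalarTower.algebraMap_apply K K[X] (RatFunc K) c
  rw [Algebra.smul_def, Algebra.smul_def, ratDeriv_mul, hc, ratDeriv_algebraMap]
  simp

variable (K)

/-- The derivation `D = d/dt` of the field `K(t)` of rational functions, as a `K`-linear map. -/
def derivMap : Module.End K (RatFunc K) where
  toFun := ratDeriv
  map_add' := ratDeriv_add
  map_smul' := ratDeriv_smul

/-- The ring `K(t)[D]` of linear ordinary differential operators with coefficients in `K(t)`,
realised by `K`-linear operators on `K(t)`: it is generated by the multiplications by rational
functions and by `D = d/dt`, and its product is the composition of operators.
(When `K` has characteristic zero, the powers of `D` are linearly independent over `K(t)` in it.) -/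
def diffOp : Subalgebra K (Module.End K (RatFunc K)) :=
  Algebra.adjoin K
    (Set.range (fun a : RatFunc K => LinearMap.mulLeft K a) ∪ {derivMap K})

variable {K}

/-- The operator of multiplication by `a`, an operator of order zero. -/
def coeff (a : RatFunc K) : diffOp K :=
  ⟨LinearMap.mulLeft K a, Algebra.subset_adjoin (Or.inl ⟨a, rfl⟩)⟩

/-- The multiplication by a polynomial. -/
def polyCoeff (p : K[X]) : diffOp K := coeff (algebraMap K[X] (RatFunc K) p)

variable (K)

/-- The operator `D = d/dt`. -/
def D : diffOp K := ⟨derivMap K, Algebra.subset_adjoin (Or.inr rfl)⟩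

/-- The operator `Δ = t D`. -/
def Delta : diffOp K := coeff RatFunc.X * D K

variable {K}

/-- The differential operator
`E(Δ, t) = N Δ ^ m - P₁ Δ ^ (m - 1) - ... - Pₘ Δ ^ 0`. -/
def E (m : ℕ) (N : K[X]) (P : ℕ → K[X]) : diffOp K :=
  polyCoeff N * Delta K ^ m - ∑ j ∈ Finset.Icc 1 m, polyCoeff (P j) * Delta K ^ (m - j)

end RatDiffOp

end

noncomputable section

namespace RatDiffOp

open Polynomial

variable {K : Type*} [Field K]

/-! Give a term `a Δ ^ i` the weight `m * deg a + i`, with `deg` the degree at infinity. The Euler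
derivation does not raise `deg`, so in `Δ a = a Δ + Δ(a)` the correction has smaller weight than `a
Δ`. Hence composition agrees with commutative multiplication of symbols up to lower weight
(`star_sub_mul_mem_weightLE`).

The top weight of `E` is `m * (S + 1)`, reached at both exponents `0` and `m`. In an operator of
order less than `m` the weights are distinct modulo `m`, so its top part is a single monomial
(`exists_top_monomial`). A product of two such operators then has a monomial as top part, so it
cannot be `E` (`star_ne_of_two_top_terms`). In Newton polygon terms, the edge from `(0, S + 1)` to
`(m, S)` has no interior lattice point. -/

/-- Multiplication operators, as a ring homomorphism. -/
def coeffHom : RatFunc K →+* diffOp K where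
  toFun := coeff
  map_one' := Subtype.ext (LinearMap.ext fun f => one_mul f)
  map_mul' a b := Subtype.ext (LinearMap.ext fun f => mul_assoc a b f)
  map_zero' := Subtype.ext (LinearMap.ext fun f => zero_mul f)
  map_add' a b := Subtype.ext (LinearMap.ext fun f => add_mul a b f)

/-! ### The Euler derivation and degrees at infinity -/

/-- The Euler derivation `t d/dt` of `K(t)`. -/
def eulerDeriv : RatFunc K →+ RatFunc K where
  toFun f := RatFunc.X * ratDeriv f
  map_zero' := by
    have h := ratDeriv_add (0 : RatFunc K) 0
    simp only [add_zero, left_eq_add] at h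
    rw [h, mul_zero]
  map_add' f g := by rw [ratDeriv_add, mul_add]

theorem eulerDeriv_apply (f : RatFunc K) : eulerDeriv f = RatFunc.X * ratDeriv f := rfl

theorem eulerDeriv_X_pow (k : ℕ) :
    eulerDeriv ((RatFunc.X : RatFunc K) ^ k) = (k : RatFunc K) * RatFunc.X ^ k := by
  rw [eulerDeriv_apply, ← RatFunc.algebraMap_X, ← map_pow, ratDeriv_algebraMap]
  cases k with
  | zero => simp
  | succ k =>
    simp only [derivative_X_pow, map_mul, map_pow, RatFunc.algebraMap_X, map_natCast,
      Nat.add_sub_cancel]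
    ring

theorem Delta_apply (f : RatFunc K) : (Delta K : Module.End K (RatFunc K)) f = eulerDeriv f := rfl

theorem Delta_mul_coeffHom (a : RatFunc K) :
    Delta K * coeffHom a = coeffHom a * Delta K + coeffHom (eulerDeriv a) := by
  refine Subtype.ext (LinearMap.ext fun f => ?_)
  change RatFunc.X * ratDeriv (a * f) =
    a * (RatFunc.X * ratDeriv f) + RatFunc.X * ratDeriv a * f
  rw [ratDeriv_mul]
  ring

/-- In `t (p' q - p q') / q ^ 2` differentiation loses at least one degree and the factor `t`
restores only one. The zero case is excluded because `intDegree 0` is `0` by convention. -/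
theorem intDegree_eulerDeriv_le (f : RatFunc K) (h : eulerDeriv f ≠ 0) :
    (eulerDeriv f).intDegree ≤ f.intDegree := by
  obtain ⟨p, q, hq, rfl⟩ := exists_div f
  rw [eulerDeriv_apply, ratDeriv_div p q hq] at *
  have hq' : algebraMap K[X] (RatFunc K) q ≠ 0 := RatFunc.algebraMap_ne_zero hq
  set r : K[X] := derivative p * q - p * derivative q with hr
  have hqr : RatFunc.X * quotRule p q =
      algebraMap K[X] (RatFunc K) (X * r) / algebraMap K[X] (RatFunc K) (q ^ 2) := by
    simp only [quotRule, hr, map_mul, map_sub, map_pow, RatFunc.algebraMap_X]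
    ring
  rw [hqr] at h ⊢
  have hXr : X * r ≠ 0 := fun h0 => h (by rw [h0, map_zero, zero_div])
  have hr0 : r ≠ 0 := right_ne_zero_of_mul hXr
  have hp : p ≠ 0 := by
    rintro rfl
    simp [hr] at hr0
  rw [RatFunc.intDegree_div (RatFunc.algebraMap_ne_zero hXr)
      (RatFunc.algebraMap_ne_zero (pow_ne_zero 2 hq)),
    RatFunc.intDegree_div (RatFunc.algebraMap_ne_zero hp) hq']
  simp only [RatFunc.intDegree_polynomial]
  rw [natDegree_X_mul hr0, natDegree_pow]
  have hdeg : r.degree < (p.natDegree + q.natDegree : ℕ) := by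
    have h1 : (derivative p * q).degree < (p.natDegree + q.natDegree : ℕ) := by
      rw [degree_mul, Nat.cast_add, ← degree_eq_natDegree hp, ← degree_eq_natDegree hq]
      exact WithBot.add_lt_add_right (degree_eq_bot.not.mpr hq) (degree_derivative_lt hp)
    have h2 : (p * derivative q).degree < (p.natDegree + q.natDegree : ℕ) := by
      rw [degree_mul, Nat.cast_add, ← degree_eq_natDegree hp, ← degree_eq_natDegree hq]
      exact WithBot.add_lt_add_left (degree_eq_bot.not.mpr hp) (degree_derivative_lt hq)
    exact (degree_sub_le _ _).trans_lt (max_lt h1 h2)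
  have := (natDegree_lt_iff_degree_lt hr0).mpr hdeg
  push_cast
  omega

/-! ### Normal forms of operators -/

/-- The operator `∑ aᵢ Δ ^ i` with normal form `∑ aᵢ X ^ i`. -/
def op (p : (RatFunc K)[X]) : diffOp K := p.eval₂ coeffHom (Delta K)

theorem op_add (p q : (RatFunc K)[X]) : op (p + q) = op p + op q := eval₂_add _ _

theorem op_monomial (i : ℕ) (a : RatFunc K) :
    op (monomial i a) = coeffHom a * Delta K ^ i := eval₂_monomial _ _

theorem op_C (a : RatFunc K) : op (C a) = coeffHom a := eval₂_C _ _

theorem op_one : op (1 : (RatFunc K)[X]) = 1 := eval₂_one _ _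

theorem op_zero : op (0 : (RatFunc K)[X]) = 0 := eval₂_zero _ _

theorem op_sum {ι : Type*} (s : Finset ι) (f : ι → (RatFunc K)[X]) :
    op (∑ i ∈ s, f i) = ∑ i ∈ s, op (f i) := eval₂_finsetSum _ _ _ _

theorem op_C_mul (a : RatFunc K) (p : (RatFunc K)[X]) : op (C a * p) = coeffHom a * op p := by
  induction p using Polynomial.induction_on' with
  | add p q hp hq => rw [mul_add, op_add, op_add, hp, hq, mul_add]
  | monomial n b => rw [C_mul_monomial, op_monomial, op_monomial, map_mul, mul_assoc]

theorem Delta_pow_apply_X_pow (i k : ℕ) :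
    ((Delta K ^ i : diffOp K) : Module.End K (RatFunc K)) (RatFunc.X ^ k) =
      (k : RatFunc K) ^ i * RatFunc.X ^ k := by
  induction i with
  | zero => simp
  | succ i ih =>
    rw [pow_succ, Subalgebra.coe_mul, Module.End.mul_apply, Delta_apply, eulerDeriv_X_pow,
      ← nsmul_eq_mul, map_nsmul, ih, nsmul_eq_mul]
    ring

theorem op_apply_X_pow (p : (RatFunc K)[X]) (k : ℕ) :
    (op p : Module.End K (RatFunc K)) (RatFunc.X ^ k) =
      p.eval (k : RatFunc K) * RatFunc.X ^ k := by
  induction p using Polynomial.induction_on' with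
  | add p q hp hq => rw [op_add, Subalgebra.coe_add, LinearMap.add_apply, hp, hq, eval_add, add_mul]
  | monomial n b =>
    rw [op_monomial, Subalgebra.coe_mul, Module.End.mul_apply, Delta_pow_apply_X_pow, eval_monomial,
      mul_assoc]
    rfl

/-- Powers of `t` are eigenvectors of `Δ`, so the operator determines the values of `p` at all
natural numbers. These are infinitely many points in characteristic zero, which is used only here.
-/
theorem op_injective [CharZero K] : Function.Injective (op (K := K)) := by
  have : CharZero (RatFunc K) :=
    charZero_of_injective_algebraMap (algebraMap K (RatFunc K)).injective
  intro p q h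
  refine eq_of_infinite_eval_eq p q
    ((Set.infinite_range_of_injective (Nat.cast_injective (R := RatFunc K))).mono ?_)
  rintro _ ⟨k, rfl⟩
  have hk := op_apply_X_pow p k
  rw [h, op_apply_X_pow] at hk
  exact (mul_right_cancel₀ (pow_ne_zero k RatFunc.X_ne_zero) hk).symm

/-- The Euler derivation acting on the coefficients of a polynomial. -/
def coeffDeriv (p : (RatFunc K)[X]) : (RatFunc K)[X] := p.sum fun i a => monomial i (eulerDeriv a)

theorem coeffDeriv_add (p q : (RatFunc K)[X]) :
    coeffDeriv (p + q) = coeffDeriv p + coeffDeriv q :=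
  sum_add_index p q _ (by simp) (by simp)

theorem coeffDeriv_monomial (i : ℕ) (a : RatFunc K) :
    coeffDeriv (monomial i a) = monomial i (eulerDeriv a) :=
  sum_monomial_index a _ (by simp)

theorem coeff_coeffDeriv (p : (RatFunc K)[X]) (i : ℕ) :
    (coeffDeriv p).coeff i = eulerDeriv (p.coeff i) := by
  induction p using Polynomial.induction_on' with
  | add p q hp hq => rw [coeffDeriv_add, coeff_add, hp, hq, coeff_add, map_add]
  | monomial n b =>
    rw [coeffDeriv_monomial, coeff_monomial, coeff_monomial]
    split_ifs <;> simp

/-- Left multiplication by `Δ` on normal forms. -/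
def deltaMul (p : (RatFunc K)[X]) : (RatFunc K)[X] := X * p + coeffDeriv p

theorem op_deltaMul (p : (RatFunc K)[X]) : op (deltaMul p) = Delta K * op p := by
  induction p using Polynomial.induction_on' with
  | add p q hp hq =>
    rw [op_add, mul_add, ← hp, ← hq, ← op_add]
    simp only [deltaMul, coeffDeriv_add]
    congr 1
    ring
  | monomial n b =>
    rw [deltaMul, coeffDeriv_monomial, op_add, X_mul_monomial, op_monomial, op_monomial,
      op_monomial, ← mul_assoc, Delta_mul_coeffHom, add_mul, mul_assoc _ (Delta K), ← pow_succ']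

theorem op_deltaMul_iterate (i : ℕ) (p : (RatFunc K)[X]) :
    op (deltaMul^[i] p) = Delta K ^ i * op p := by
  induction i with
  | zero => simp
  | succ i ih => rw [Function.iterate_succ_apply', op_deltaMul, ih, pow_succ', mul_assoc]

/-- The composition of operators on normal forms. -/
def star (p q : (RatFunc K)[X]) : (RatFunc K)[X] :=
  ∑ i ∈ p.support, C (p.coeff i) * deltaMul^[i] q

theorem op_star (p q : (RatFunc K)[X]) : op (star p q) = op p * op q := by
  conv_rhs => rw [p.as_sum_support, op_sum, Finset.sum_mul]
  rw [star, op_sum]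
  refine Finset.sum_congr rfl fun i _ => ?_
  rw [op_C_mul, op_deltaMul_iterate, op_monomial, mul_assoc]

theorem op_surjective : Function.Surjective (op (K := K)) := by
  rintro ⟨A, hA⟩
  suffices h : ∃ p : (RatFunc K)[X], ((op p : diffOp K) : Module.End K (RatFunc K)) = A by
    obtain ⟨p, hp⟩ := h
    exact ⟨p, Subtype.ext hp⟩
  refine Algebra.adjoin_induction
    (p := fun A _ => ∃ p : (RatFunc K)[X], ((op p : diffOp K) : Module.End K (RatFunc K)) = A)
    ?_ ?_ ?_ ?_ hA
  · rintro _ (⟨a, rfl⟩ | rfl)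
    · exact ⟨C a, by rw [op_C]; rfl⟩
    -- The generator `D` is `t⁻¹ Δ`.
    · refine ⟨monomial 1 RatFunc.X⁻¹, ?_⟩
      rw [op_monomial, pow_one]
      refine LinearMap.ext fun f => ?_
      exact inv_mul_cancel_left₀ RatFunc.X_ne_zero (ratDeriv f)
  · intro r
    refine ⟨C (algebraMap K (RatFunc K) r), ?_⟩
    rw [op_C]
    exact LinearMap.ext fun f => (Algebra.smul_def r f).symm
  · rintro _ _ _ _ ⟨p, rfl⟩ ⟨q, rfl⟩
    exact ⟨p + q, by rw [op_add]; rfl⟩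
  · rintro _ _ _ _ ⟨p, rfl⟩ ⟨q, rfl⟩
    exact ⟨star p q, by rw [op_star]; rfl⟩

/-! ### The weight filtration -/

/-- The polynomials `∑ aᵢ X ^ i` over `K(t)` whose terms all have weight `c * deg aᵢ + i` at most
`w`, where `deg` is the degree in `t`. -/
def weightLE (c : ℕ) (w : ℤ) : AddSubgroup (RatFunc K)[X] where
  carrier := {p | ∀ i, p.coeff i ≠ 0 → c * (p.coeff i).intDegree + i ≤ w}
  zero_mem' i h := absurd (coeff_zero i) h
  neg_mem' {p} hp i h := by
    rw [coeff_neg] at h ⊢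
    rw [RatFunc.intDegree_neg]
    exact hp i (neg_ne_zero.mp h)
  add_mem' {p q} hp hq i h := by
    rw [coeff_add] at h ⊢
    rcases eq_or_ne (p.coeff i) 0 with h1 | h1
    · rw [h1, zero_add] at h ⊢
      exact hq i h
    rcases eq_or_ne (q.coeff i) 0 with h2 | h2
    · rw [h2, add_zero] at h ⊢
      exact hp i h
    have hle := mul_le_mul_of_nonneg_left (RatFunc.intDegree_add_le h2 h) (Int.natCast_nonneg c)
    have h3 := hp i h1
    have h4 := hq i h2
    rcases max_cases (p.coeff i).intDegree (q.coeff i).intDegree with ⟨hm, _⟩ | ⟨hm, _⟩ <;>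
      rw [hm] at hle <;> linarith

theorem weightLE_mono {c : ℕ} {v w : ℤ} (h : v ≤ w) {p : (RatFunc K)[X]} (hp : p ∈ weightLE c v) :
    p ∈ weightLE c w := fun i hi => (hp i hi).trans h

theorem monomial_mem_weightLE {c i : ℕ} {w : ℤ} {a : RatFunc K}
    (h : a ≠ 0 → c * a.intDegree + i ≤ w) : monomial i a ∈ weightLE c w := by
  intro j hj
  rw [coeff_monomial] at hj ⊢
  split_ifs at hj ⊢ with hij
  · exact hij ▸ h hj
  · exact absurd rfl hj

theorem mul_mem_weightLE {c : ℕ} {v w : ℤ} {p q : (RatFunc K)[X]} (hp : p ∈ weightLE c v)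
    (hq : q ∈ weightLE c w) : p * q ∈ weightLE c (v + w) := by
  rw [p.as_sum_support, q.as_sum_support, Finset.sum_mul_sum]
  refine sum_mem fun i _ => sum_mem fun j _ => ?_
  rw [monomial_mul_monomial]
  refine monomial_mem_weightLE fun h => ?_
  have h1 := left_ne_zero_of_mul h
  have h2 := right_ne_zero_of_mul h
  have h3 := hp i h1
  have h4 := hq j h2
  rw [RatFunc.intDegree_mul h1 h2]
  push_cast
  linarith

theorem coeffDeriv_mem_weightLE {c : ℕ} {w : ℤ} {p : (RatFunc K)[X]} (hp : p ∈ weightLE c w) :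
    coeffDeriv p ∈ weightLE c w := by
  intro i hi
  rw [coeff_coeffDeriv] at hi ⊢
  have h0 : p.coeff i ≠ 0 := fun h => hi (by rw [h, map_zero])
  have := mul_le_mul_of_nonneg_left (intDegree_eulerDeriv_le _ hi) (Int.natCast_nonneg c)
  linarith [hp i h0]

theorem X_pow_mem_weightLE (c i : ℕ) : (X ^ i : (RatFunc K)[X]) ∈ weightLE c i := by
  rw [X_pow_eq_monomial]
  exact monomial_mem_weightLE fun _ => by simp

theorem X_mem_weightLE (c : ℕ) : (X : (RatFunc K)[X]) ∈ weightLE c 1 := by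
  simpa using X_pow_mem_weightLE (K := K) c 1

/-- Each `Δ` raises the weight by at most one when it acts as multiplication by `X`, and by nothing
when it differentiates coefficients. Every correction thus loses at least one. -/
theorem deltaMul_iterate_sub_mem_weightLE {c : ℕ} {w : ℤ} {q : (RatFunc K)[X]}
    (hq : q ∈ weightLE c w) (i : ℕ) : deltaMul^[i] q - X ^ i * q ∈ weightLE c (i + w - 1) := by
  induction i with
  | zero => simp
  | succ i ih =>
    have h1 : deltaMul^[i] q ∈ weightLE c (i + w) := by
      have := add_mem (weightLE_mono (by omega) ih) (mul_mem_weightLE (X_pow_mem_weightLE c i) hq)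
      rwa [sub_add_cancel] at this
    have h2 : deltaMul^[i + 1] q - X ^ (i + 1) * q =
        X * (deltaMul^[i] q - X ^ i * q) + coeffDeriv (deltaMul^[i] q) := by
      rw [Function.iterate_succ_apply', deltaMul]
      ring
    rw [h2]
    push_cast
    exact add_mem (weightLE_mono (by omega) (mul_mem_weightLE (X_mem_weightLE c) ih))
      (weightLE_mono (by omega) (coeffDeriv_mem_weightLE h1))

/-- Composition of operators is commutative multiplication of symbols, up to lower weight. -/
theorem star_sub_mul_mem_weightLE {c : ℕ} {v w : ℤ} {p q : (RatFunc K)[X]}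
    (hp : p ∈ weightLE c v) (hq : q ∈ weightLE c w) :
    star p q - p * q ∈ weightLE c (v + w - 1) := by
  conv in p * q => rw [p.as_sum_support, Finset.sum_mul]
  rw [star, ← Finset.sum_sub_distrib]
  refine sum_mem fun i hi => ?_
  rw [← C_mul_X_pow_eq_monomial, mul_assoc, ← mul_sub]
  have hC : (C (p.coeff i) : (RatFunc K)[X]) ∈ weightLE c (v - i) := by
    rw [← monomial_zero_left]
    refine monomial_mem_weightLE fun h => ?_
    have := hp i h
    push_cast
    linarith
  exact weightLE_mono (by omega) (mul_mem_weightLE hC (deltaMul_iterate_sub_mem_weightLE hq i))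

/-- For `c = 0` the weight is the order, so the same filtration also controls leading coefficients
of products. -/
theorem mem_weightLE_zero_natDegree (p : (RatFunc K)[X]) : p ∈ weightLE 0 p.natDegree := by
  intro i hi
  simpa using le_natDegree_of_ne_zero hi

theorem coeff_star_natDegree_add (p q : (RatFunc K)[X]) :
    (star p q).coeff (p.natDegree + q.natDegree) = p.leadingCoeff * q.leadingCoeff := by
  have h := star_sub_mul_mem_weightLE (mem_weightLE_zero_natDegree p)
    (mem_weightLE_zero_natDegree q)
  rw [← coeff_mul_degree_add_degree, ← sub_eq_zero, ← coeff_sub]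
  by_contra hne
  have := h _ hne
  push_cast at this
  linarith

theorem natDegree_add_le_natDegree_star {p q : (RatFunc K)[X]} (hp : p ≠ 0) (hq : q ≠ 0) :
    p.natDegree + q.natDegree ≤ (star p q).natDegree := by
  apply le_natDegree_of_ne_zero
  rw [coeff_star_natDegree_add]
  exact mul_ne_zero (leadingCoeff_ne_zero.mpr hp) (leadingCoeff_ne_zero.mpr hq)

theorem isUnit_op_of_natDegree_eq_zero {p : (RatFunc K)[X]} (hp : p ≠ 0) (h : p.natDegree = 0) :
    IsUnit (op p) := by
  rw [eq_C_of_natDegree_eq_zero h] at hp ⊢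
  rw [op_C]
  exact (IsUnit.mk0 _ (C_ne_zero.mp hp)).map coeffHom

/-! ### Top parts of factors and products -/

/-- A polynomial of degree less than `m` has a single term of top weight, because the weight of a
term determines its exponent modulo `m`. -/
theorem exists_top_monomial {m : ℕ} {p : (RatFunc K)[X]} (hp : p ≠ 0) (hm : p.natDegree < m) :
    ∃ (i : ℕ) (a : RatFunc K), a ≠ 0 ∧ p ∈ weightLE m (m * a.intDegree + i) ∧
      p - monomial i a ∈ weightLE m (m * a.intDegree + i - 1) := by
  obtain ⟨i, hi, hmax⟩ := p.support.exists_max_image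
    (fun i => (m : ℤ) * (p.coeff i).intDegree + i) (support_nonempty.mpr hp)
  refine ⟨i, p.coeff i, mem_support_iff.mp hi, fun j hj => hmax j (mem_support_iff.mpr hj), ?_⟩
  intro j hj
  rw [coeff_sub, coeff_monomial] at hj ⊢
  split_ifs at hj ⊢ with hij
  · exact absurd (by rw [hij, sub_self]) hj
  rw [sub_zero] at hj ⊢
  refine Int.le_sub_one_of_lt (lt_of_le_of_ne (hmax j (mem_support_iff.mpr hj)) fun heq => hij ?_)
  have hjm := (le_natDegree_of_ne_zero hj).trans_lt hm
  have him := (le_natDegree_of_mem_supp i hi).trans_lt hm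
  have hmod := congrArg (· % (m : ℤ)) heq
  simp only [Int.mul_add_emod_self_left] at hmod
  rw [Int.emod_eq_of_lt (by omega) (by omega), Int.emod_eq_of_lt (by omega) (by omega)] at hmod
  omega

/-- A polynomial attaining its maximal weight at two exponents `0` and `m` is not the normal form
of a product of operators of orders less than `m`. -/
theorem star_ne_of_two_top_terms {m : ℕ} (hm : 0 < m) {e p q : (RatFunc K)[X]} {w : ℤ}
    (hp0 : p ≠ 0) (hq0 : q ≠ 0) (he : e ∈ weightLE m w)
    (h0 : e.coeff 0 ≠ 0) (h0w : m * (e.coeff 0).intDegree = w)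
    (hm0 : e.coeff m ≠ 0) (hmw : m * (e.coeff m).intDegree + m = w)
    (hp : p.natDegree < m) (hq : q.natDegree < m) : star p q ≠ e := by
  intro h
  obtain ⟨i, a, ha, hpa, hpa'⟩ := exists_top_monomial hp0 hp
  obtain ⟨j, b, hb, hqb, hqb'⟩ := exists_top_monomial hq0 hq
  set v : ℤ := m * a.intDegree + i with hv
  set u : ℤ := m * b.intDegree + j with hu
  have hrest : e - monomial (i + j) (a * b) ∈ weightLE m (v + u - 1) := by
    have h1 := star_sub_mul_mem_weightLE hpa hqb
    have h2 := mul_mem_weightLE hpa' hqb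
    have h3 := mul_mem_weightLE (monomial_mem_weightLE (fun _ => hv.ge)) hqb'
    have h4 : e - monomial (i + j) (a * b) = (star p q - p * q) + (p - monomial i a) * q +
        monomial i a * (q - monomial j b) := by
      rw [h, ← monomial_mul_monomial]
      ring
    rw [h4]
    exact add_mem (add_mem h1 (weightLE_mono (by omega) h2)) (weightLE_mono (by omega) h3)
  have hcoeff : ∀ k, k ≠ i + j → e.coeff k ≠ 0 → m * (e.coeff k).intDegree + k ≤ v + u - 1 := by
    intro k hk hek
    have := hrest k
    rw [coeff_sub, coeff_monomial, if_neg (Ne.symm hk), sub_zero] at this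
    exact this hek
  -- At least one of the exponents `0` and `m` differs from `i + j`. The term of `e` there has
  -- weight `w` and survives in the remainder.
  have hlt : w < v + u := by
    rcases eq_or_ne (i + j) 0 with hij | hij
    · have := hcoeff m (by omega) hm0
      omega
    · have := hcoeff 0 (Ne.symm hij) h0
      push_cast at this
      omega
  -- Now `e` and the remainder both have weight below `v + u`, hence so does their difference, a
  -- monomial of weight exactly `v + u`.
  have hmem : monomial (i + j) (a * b) ∈ weightLE (K := K) m (v + u - 1) := by
    have := sub_mem (weightLE_mono (Int.le_sub_one_of_lt hlt) he) hrest
    rwa [sub_sub_cancel] at this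
  have htop := hmem (i + j)
  rw [coeff_monomial_same, RatFunc.intDegree_mul ha hb] at htop
  have := htop (mul_ne_zero ha hb)
  push_cast at this
  linarith

/-! ### The symbol of `E` and irreducibility -/

/-- The normal form of `E m N P`. -/
def symbolE (m : ℕ) (N : K[X]) (P : ℕ → K[X]) : (RatFunc K)[X] :=
  monomial m (algebraMap K[X] (RatFunc K) N) -
    ∑ j ∈ Finset.Icc 1 m, monomial (m - j) (algebraMap K[X] (RatFunc K) (P j))

theorem op_symbolE (m : ℕ) (N : K[X]) (P : ℕ → K[X]) : op (symbolE m N P) = E m N P := by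
  have h : op (symbolE m N P) +
      op (∑ j ∈ Finset.Icc 1 m, monomial (m - j) (algebraMap K[X] (RatFunc K) (P j))) =
      op (monomial m (algebraMap K[X] (RatFunc K) N)) := by
    rw [← op_add, symbolE, sub_add_cancel]
  rw [eq_sub_of_add_eq h, op_sum]
  simp only [op_monomial]
  rfl

theorem coeff_symbolE_self {m : ℕ} (N : K[X]) (P : ℕ → K[X]) :
    (symbolE m N P).coeff m = algebraMap K[X] (RatFunc K) N := by
  rw [symbolE, coeff_sub, coeff_monomial_same, finsetSum_coeff, Finset.sum_eq_zero, sub_zero]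
  intro j hj
  rw [Finset.mem_Icc] at hj
  exact coeff_monomial_of_ne _ (by omega)

theorem coeff_symbolE_zero {m : ℕ} (hm : 0 < m) (N : K[X]) (P : ℕ → K[X]) :
    (symbolE m N P).coeff 0 = -algebraMap K[X] (RatFunc K) (P m) := by
  rw [symbolE, coeff_sub, coeff_monomial_of_ne _ (by omega), finsetSum_coeff,
    Finset.sum_eq_single_of_mem m (Finset.mem_Icc.mpr ⟨hm, le_rfl⟩), Nat.sub_self,
    coeff_monomial_same, zero_sub]
  intro j hj hjm
  rw [Finset.mem_Icc] at hj
  exact coeff_monomial_of_ne _ (by omega)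

theorem natDegree_symbolE_le (m : ℕ) (N : K[X]) (P : ℕ → K[X]) :
    (symbolE m N P).natDegree ≤ m := by
  refine (natDegree_sub_le _ _).trans (max_le (natDegree_monomial_le _) ?_)
  exact natDegree_sum_le_of_forall_le _ _ fun j _ =>
    (natDegree_monomial_le _).trans (Nat.sub_le m j)

/-- The intermediate terms need only not exceed the weight of the two extreme ones. -/
theorem symbolE_mem_weightLE {m : ℕ} {N : K[X]} {P : ℕ → K[X]}
    (hPm : (P m).natDegree = N.natDegree + 1)
    (hP : ∀ j, 1 ≤ j → j ≤ m - 1 → (P j).natDegree ≤ N.natDegree) :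
    symbolE m N P ∈ weightLE m (m * (N.natDegree + 1)) := by
  refine sub_mem (monomial_mem_weightLE fun _ => ?_)
    (sum_mem fun j hj => monomial_mem_weightLE fun _ => ?_)
  · rw [RatFunc.intDegree_polynomial]
    linarith
  · rw [RatFunc.intDegree_polynomial]
    rw [Finset.mem_Icc] at hj
    rcases eq_or_ne j m with rfl | hjm
    · rw [hPm, Nat.sub_self]
      push_cast
      linarith
    · have h1 : (m : ℤ) * (P j).natDegree ≤ m * N.natDegree := by
        have := hP j hj.1 (by omega)
        gcongr
      have h2 : ((m - j : ℕ) : ℤ) ≤ m := by omega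
      linarith

theorem irreducible_E [CharZero K] (m : ℕ) (hm : 2 ≤ m) (N : K[X]) (P : ℕ → K[X])
    (hN : 0 ≤ N.degree)
    (hPm : (P m).degree = N.degree + 1)
    (hP : ∀ j, 1 ≤ j → j ≤ m - 1 → (P j).degree < (P m).degree) :
    Irreducible (E m N P) := by
  have hN0 : N ≠ 0 := zero_le_degree_iff.mp hN
  have hPdeg : (P m).degree = (N.natDegree + 1 : ℕ) := by
    rw [hPm, degree_eq_natDegree hN0]
    rfl
  have hPnat : (P m).natDegree = N.natDegree + 1 := natDegree_eq_of_degree_eq_some hPdeg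
  have hPm0 : P m ≠ 0 := by
    rintro h
    rw [h, natDegree_zero] at hPnat
    omega
  have hPle : ∀ j, 1 ≤ j → j ≤ m - 1 → (P j).natDegree ≤ N.natDegree := by
    intro j h1 h2
    have h3 := hP j h1 h2
    rw [hPdeg] at h3
    rcases eq_or_ne (P j) 0 with h | h
    · simp [h]
    · exact Nat.lt_succ_iff.mp ((natDegree_lt_iff_degree_lt h).mpr h3)
  have hem : (symbolE m N P).coeff m ≠ 0 := by
    rw [coeff_symbolE_self]
    exact RatFunc.algebraMap_ne_zero hN0
  have he0 : (symbolE m N P).coeff 0 ≠ 0 := by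
    rw [coeff_symbolE_zero (by omega)]
    exact neg_ne_zero.mpr (RatFunc.algebraMap_ne_zero hPm0)
  have hne : symbolE m N P ≠ 0 := fun h => he0 (by rw [h, coeff_zero])
  rw [← op_symbolE]
  constructor
  · intro hu
    obtain ⟨B, hB⟩ := hu.exists_right_inv
    obtain ⟨q, rfl⟩ := op_surjective B
    rw [← op_star, ← op_one] at hB
    have h := op_injective hB
    have hq : q ≠ 0 := by
      rintro rfl
      have h1 : op (star (symbolE m N P) 0) = 0 := by rw [op_star, op_zero, mul_zero]
      rw [h, ← op_zero] at h1
      exact one_ne_zero (op_injective h1)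
    -- A right inverse would force the order of `E`, at least `m`, to be at most that of `1`.
    have h2 := natDegree_add_le_natDegree_star hne hq
    rw [h, natDegree_one] at h2
    have h3 := le_natDegree_of_ne_zero hem
    omega
  · intro A B hAB
    obtain ⟨p, rfl⟩ := op_surjective A
    obtain ⟨q, rfl⟩ := op_surjective B
    have hp : p ≠ 0 := by
      rintro rfl
      rw [op_zero, zero_mul, ← op_zero] at hAB
      exact hne (op_injective hAB)
    have hq : q ≠ 0 := by
      rintro rfl
      rw [op_zero, mul_zero, ← op_zero] at hAB
      exact hne (op_injective hAB)
    rw [← op_star] at hAB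
    have h := op_injective hAB
    have hdeg := natDegree_add_le_natDegree_star hp hq
    rw [← h] at hdeg
    have hle := hdeg.trans (natDegree_symbolE_le m N P)
    rcases Nat.eq_zero_or_pos p.natDegree with hp1 | hp1
    · exact Or.inl (isUnit_op_of_natDegree_eq_zero hp hp1)
    rcases Nat.eq_zero_or_pos q.natDegree with hq1 | hq1
    · exact Or.inr (isUnit_op_of_natDegree_eq_zero hq hq1)
    -- Both orders are positive with sum at most `m`, so each is less than `m`.
    refine absurd h.symm (star_ne_of_two_top_terms (by omega) hp hq
      (symbolE_mem_weightLE hPnat hPle)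
      he0 ?_ hem ?_ (by omega) (by omega))
    · rw [coeff_symbolE_zero (by omega), RatFunc.intDegree_neg, RatFunc.intDegree_polynomial,
        hPnat]
      push_cast
      ring
    · rw [coeff_symbolE_self, RatFunc.intDegree_polynomial]
      ring

end RatDiffOp

end

theorem mainTheorem2 {K : Type*} [Field K] [CharZero K] (m : ℕ) (hm : 2 ≤ m)
    (N : Polynomial K) (P : ℕ → Polynomial K)
    (hN : 0 ≤ N.degree)
    (hPm : (P m).degree = N.degree + 1)
    (hP : ∀ j, 1 ≤ j → j ≤ m - 1 → (P j).degree < (P m).degree) :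
    Irreducible (RatDiffOp.E m N P) := by
  exact RatDiffOp.irreducible_E m hm N P hN hPm hP
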